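/- Let $n\ge 3$ and let $f,g:[n]\to[n]$ be functions without fixed points, where $[n]=\{1,\dots,n\}$. The pair $(f,g)$ is called realizable in a metric space $(X,d)$ if there are points $A_1,\dots,A_n\in X$ such that the distances $d(A_i,A_j)$ are distinct for different pairs $\{i,j\}$ with $i\ne j$, and for every $i$ we have $d(A_i,A_{f(i)})<d(A_i,A_j)$ for all $j\ne i,f(i)$, and $d(A_i,A_{g(i)})>d(A_i,A_j)$ for all $j\neq i,g(i)$. The pair is called realizable if it is realizable in some metric space. For a positive integer $k$, let $m(k)$ be the largest $n\ge 3$ such that every realizable pair $(f,g)$ of functions $[n]\to[n]$ is realizable in $\mathbb{R}^k$ with the Euclidean metric. Then $m(k)$ exists for every positive integer $k$, and there are constants $A,B>0$ and $c,C>1$ such that for every positive integer $k$, $$A c^k< m(k)< B C^k .$$ -/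

import Mathlib

/-- The pair `(f, g)` of self-maps of an `n`-element set, both without fixed points, is realizable
in the metric space `X`: there are points `A i` with pairwise distinct mutual distances such that
`A (f i)` is strictly closest to `A i` and `A (g i)` is strictly farthest from `A i`. -/
def RealizableIn (X : Type*) [MetricSpace X] {n : ℕ} (f g : Fin n → Fin n) : Prop :=
  (∀ i, f i ≠ i) ∧ (∀ i, g i ≠ i) ∧
    ∃ A : Fin n → X,
      (∀ i j p q : Fin n, i ≠ j → p ≠ q →
        dist (A i) (A j) = dist (A p) (A q) → s(i, j) = s(p, q)) ∧
      (∀ i j : Fin n, j ≠ i → j ≠ f i → dist (A i) (A (f i)) < dist (A i) (A j)) ∧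
      (∀ i j : Fin n, j ≠ i → j ≠ g i → dist (A i) (A j) < dist (A i) (A (g i)))

/-- The pair `(f, g)` is realizable: it is realizable in some metric space. Only the finitely many
points `A i` matter, so the universe of the space is irrelevant, see
`RealizableIn.realizable`. -/
def Realizable {n : ℕ} (f g : Fin n → Fin n) : Prop :=
  ∃ (X : Type) (_ : MetricSpace X), RealizableIn X f g

/-- A pair realizable in a metric space of any universe is realizable. -/
theorem RealizableIn.realizable {X : Type*} [MetricSpace X] {n : ℕ} {f g : Fin n → Fin n}
    (h : RealizableIn X f g) : Realizable f g := by
  obtain ⟨hf, hg, A, h1, h2, h3⟩ := h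
  let e := Finite.equivFin (Set.range A)
  let F : Fin (Nat.card (Set.range A)) → X := fun a => (e.symm a : X)
  have hF : Function.Injective F := Subtype.val_injective.comp e.symm.injective
  let B : Fin n → Fin (Nat.card (Set.range A)) := fun i => e ⟨A i, i, rfl⟩
  have hB : ∀ i, F (B i) = A i := fun i => congrArg Subtype.val (e.symm_apply_apply ⟨A i, i, rfl⟩)
  refine ⟨_, MetricSpace.induced F hF inferInstance, hf, hg, B, ?_, ?_, ?_⟩
  · intro i j s t hij hst hd
    change dist (F (B i)) (F (B j)) = dist (F (B s)) (F (B t)) at hd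
    rw [hB, hB, hB, hB] at hd
    exact h1 i j s t hij hst hd
  · intro i j hj hj'
    change dist (F (B i)) (F (B (f i))) < dist (F (B i)) (F (B j))
    rw [hB, hB, hB]
    exact h2 i j hj hj'
  · intro i j hj hj'
    change dist (F (B i)) (F (B j)) < dist (F (B i)) (F (B (g i)))
    rw [hB, hB, hB]
    exact h3 i j hj hj'

/-- The sizes `n ≥ 3` for which every realizable pair on an `n`-element set is realizable
in Euclidean `ℝ^k`. -/
def euclideanSizes (k : ℕ) : Set ℕ :=
  {n | 3 ≤ n ∧ ∀ f g : Fin n → Fin n, Realizable f g →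
    RealizableIn (EuclideanSpace ℝ (Fin k)) f g}

/-- The largest element of `euclideanSizes k` (meaningful when that set is nonempty and bounded). -/
noncomputable def maxEuclideanSize (k : ℕ) : ℕ := sSup (euclideanSizes k)

/-! Upper bound. Let o be the nearest point to all the others. In a triangle o, A_i, A_j the side
A_i A_j is then the longest, so directions from o are at least 60° apart, and a packing bound allows
at most 5^k of them in ℝ^k (`le_of_mem_euclideanSizes`). Such pairs exist for every n
(`exists_realizable_star`).

Lower bound. Since m(k) is a maximum, one exponentially large n that works is enough. ℝ^k contains
exponentially many nearly orthogonal unit vectors (`exists_nearly_orthonormal`), with all squared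
distances close to 2. Adding to each vector a small combination of at most three others prescribes
the squared distances on a sparse set of pairs and barely changes the rest (`exists_tuned`). So make
the pairs {i, f i} slightly short and the pairs {i, g i} slightly long, each kind ordered as in the
given metric. The only conflict is a pair of both kinds. There is at most one (`far_near_unique`),
and an intermediate value for it works once the other pairs at one of its ends are raised too
(`of_near_targetSq`). Distinctness of the distances comes from a final perturbation
(`RealizableIn.of_strict`). -/

open Filter Topology Set

/-! ### Perturbation to distinct distances -/

/-- The mutual distances of the points `A i` are pairwise distinct. -/
def DistinctDists {X : Type*} [MetricSpace X] {n : ℕ} (A : Fin n → X) : Prop :=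
  ∀ i j p q : Fin n, i ≠ j → p ≠ q →
    dist (A i) (A j) = dist (A p) (A q) → s(i, j) = s(p, q)

theorem two_pow_sub_injective {i j p q : ℕ} (hij : j < i) (hpq : q < p)
    (h : (2 : ℝ) ^ i - 2 ^ j = 2 ^ p - 2 ^ q) : i = p ∧ j = q := by
  -- Both 2^j and 2^p are at most half of 2^i, so 2^i - 2^j ≥ 2^p > 2^p - 2^q.
  have key : ∀ {i j p q : ℕ}, j < i → p < i → (2 : ℝ) ^ i - 2 ^ j ≠ 2 ^ p - 2 ^ q := by
    intro i j p q hj hp h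
    have h1 : (2 : ℝ) ^ (j + 1) ≤ 2 ^ i := pow_le_pow_right₀ (by norm_num) hj
    have h2 : (2 : ℝ) ^ (p + 1) ≤ 2 ^ i := pow_le_pow_right₀ (by norm_num) hp
    have h3 : (0 : ℝ) < 2 ^ q := by positivity
    rw [pow_succ] at h1 h2
    linarith
  rcases lt_trichotomy i p with hip | hip | hip
  · exact absurd h.symm (key hpq hip)
  · subst hip
    refine ⟨rfl, ?_⟩
    have : (2 : ℝ) ^ j = 2 ^ q := by linarith
    exact pow_right_injective₀ (by norm_num) (by norm_num) this
  · exact absurd h (key hij hip)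

theorem sq_two_pow_sub_ne {n : ℕ} {i j p q : Fin n} (hij : i ≠ j) (hpq : p ≠ q)
    (h : s(i, j) ≠ s(p, q)) :
    ((2 : ℝ) ^ (i : ℕ) - 2 ^ (j : ℕ)) ^ 2 ≠ (2 ^ (p : ℕ) - 2 ^ (q : ℕ)) ^ 2 := by
  wlog h1 : j < i generalizing i j
  · have := this hij.symm (by rwa [Sym2.eq_swap]) (lt_of_le_of_ne (not_lt.1 h1) hij)
    rwa [← neg_sub, neg_sq] at this
  wlog h2 : q < p generalizing p q
  · have := this hpq.symm (by rwa [Sym2.eq_swap (a := q)]) (lt_of_le_of_ne (not_lt.1 h2) hpq)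
    rwa [← neg_sub ((2 : ℝ) ^ (p : ℕ)), neg_sq] at this
  intro h3
  have hpos : ∀ {a b : Fin n}, b < a → (0 : ℝ) ≤ 2 ^ (a : ℕ) - 2 ^ (b : ℕ) := fun {a b} hab =>
    sub_nonneg.2 (pow_le_pow_right₀ (by norm_num) (Fin.lt_def.1 hab).le)
  rw [sq_eq_sq₀ (hpos h1) (hpos h2)] at h3
  obtain ⟨h4, h5⟩ := two_pow_sub_injective h1 h2 h3
  exact h (by rw [Fin.ext h4, Fin.ext h5])

theorem finite_setOf_quadratic_eq_zero {a : ℝ} (ha : a ≠ 0) (b c : ℝ) :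
    {s : ℝ | a * s ^ 2 + b * s + c = 0}.Finite := by
  let P : Polynomial ℝ := Polynomial.C a * Polynomial.X ^ 2 + Polynomial.C b * Polynomial.X +
    Polynomial.C c
  have hP : P ≠ 0 := by
    intro h
    have := Polynomial.leadingCoeff_quadratic (b := b) (c := c) ha
    rw [show Polynomial.C a * Polynomial.X ^ 2 + Polynomial.C b * Polynomial.X +
      Polynomial.C c = 0 from h, Polynomial.leadingCoeff_zero] at this
    exact ha this.symm
  refine (Polynomial.finite_setOfPred_isRoot hP).subset fun s hs => ?_
  simpa [P, Polynomial.IsRoot] using hs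

theorem dist_sq_add_smul {E : Type*} [NormedAddCommGroup E] [InnerProductSpace ℝ E]
    (x y v : E) (hv : ‖v‖ = 1) (s a b : ℝ) :
    dist (x + (s * a) • v) (y + (s * b) • v) ^ 2 =
      (a - b) ^ 2 * s ^ 2 + 2 * (a - b) * inner ℝ (x - y) v * s + ‖x - y‖ ^ 2 := by
  rw [dist_eq_norm, show x + (s * a) • v - (y + (s * b) • v) = (x - y) + (s * (a - b)) • v by
    module, norm_add_sq_real, norm_smul, hv, inner_smul_right, Real.norm_eq_abs, mul_one, sq_abs]
  ring

/-- Move the i-th point by s·2^i along a fixed unit vector. Squared distances become quadratics in s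
with distinct leading coefficients (2^i - 2^j)^2, so each coincidence excludes only finitely many s.
-/
theorem dense_distinctDists {E : Type*} [NormedAddCommGroup E] [InnerProductSpace ℝ E]
    [Nontrivial E] (n : ℕ) : Dense {A : Fin n → E | DistinctDists A} := by
  rw [dense_iff_inter_open]
  rintro U hU ⟨A, hA⟩
  obtain ⟨v, hv⟩ := exists_norm_eq E zero_le_one
  let B : ℝ → Fin n → E := fun s i => A i + (s * 2 ^ (i : ℕ)) • v
  have hB : Continuous B := by fun_prop
  have h0 : B 0 = A := by funext i; simp [B]
  have h1 : ∀ᶠ s in 𝓝[≠] (0 : ℝ), B s ∈ U :=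
    (hB.continuousAt.eventually (by rw [h0]; exact hU.mem_nhds hA)).filter_mono
      nhdsWithin_le_nhds
  have h2 : ∀ᶠ s in 𝓝[≠] (0 : ℝ), DistinctDists (B s) := by
    have : ∀ i j p q : Fin n, ∀ᶠ s in 𝓝[≠] (0 : ℝ), i ≠ j → p ≠ q →
        dist (B s i) (B s j) = dist (B s p) (B s q) → s(i, j) = s(p, q) := by
      intro i j p q
      by_cases hs : s(i, j) = s(p, q)
      · exact Eventually.of_forall fun s _ _ _ => hs
      by_cases hij : i = j
      · exact Eventually.of_forall fun s h => absurd hij h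
      by_cases hpq : p = q
      · exact Eventually.of_forall fun s _ h => absurd hpq h
      have hfin := finite_setOf_quadratic_eq_zero
        (sub_ne_zero.2 (sq_two_pow_sub_ne hij hpq hs))
        (2 * ((2 : ℝ) ^ (i : ℕ) - 2 ^ (j : ℕ)) * inner ℝ (A i - A j) v -
          2 * (2 ^ (p : ℕ) - 2 ^ (q : ℕ)) * inner ℝ (A p - A q) v)
        (‖A i - A j‖ ^ 2 - ‖A p - A q‖ ^ 2)
      filter_upwards [nhdsNE_le_cofinite 0 hfin.compl_mem_cofinite] with s hs' _ _ heq
      refine absurd ?_ hs'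
      have := congrArg (· ^ 2) heq
      simp only [B, dist_sq_add_smul _ _ _ hv] at this
      simp only [mem_ofPred_eq]
      linarith
    simp only [DistinctDists, eventually_all] at this ⊢
    exact this
  obtain ⟨s, hs1, hs2⟩ := (h1.and h2).exists
  exact ⟨B s, hs1, hs2⟩

/-- Distinctness of the distances can be achieved by a perturbation. -/
theorem RealizableIn.of_strict {E : Type*} [NormedAddCommGroup E] [InnerProductSpace ℝ E]
    [Nontrivial E] {n : ℕ} {f g : Fin n → Fin n} (hf : ∀ i, f i ≠ i) (hg : ∀ i, g i ≠ i)
    (A : Fin n → E)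
    (h1 : ∀ i j : Fin n, j ≠ i → j ≠ f i → dist (A i) (A (f i)) < dist (A i) (A j))
    (h2 : ∀ i j : Fin n, j ≠ i → j ≠ g i → dist (A i) (A j) < dist (A i) (A (g i))) :
    RealizableIn E f g := by
  let U : Set (Fin n → E) := {A |
    (∀ i j : Fin n, j ≠ i → j ≠ f i → dist (A i) (A (f i)) < dist (A i) (A j)) ∧
    (∀ i j : Fin n, j ≠ i → j ≠ g i → dist (A i) (A j) < dist (A i) (A (g i)))}
  have hU : IsOpen U := by
    simp only [U, ofPred_and, ofPred_forall]
    refine IsOpen.inter ?_ ?_ <;>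
    exact isOpen_iInter_of_finite fun i => isOpen_iInter_of_finite fun j =>
      isOpen_iInter_of_finite fun _ => isOpen_iInter_of_finite fun _ =>
        isOpen_lt (by fun_prop) (by fun_prop)
  obtain ⟨B, ⟨hB1, hB2⟩, hB⟩ := (dense_distinctDists (E := E) n).inter_open_nonempty U hU
    ⟨A, h1, h2⟩
  exact ⟨hf, hg, B, hB, hB1, hB2⟩

/-! ### Upper bound: stars and packing of directions -/

theorem exists_nearest_farthest {X : Type*} [MetricSpace X] {n : ℕ} (hn : 2 ≤ n) (A : Fin n → X)
    (hA : DistinctDists A) : ∃ f g : Fin n → Fin n, RealizableIn X f g ∧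
      ∀ i j, j ≠ i → (∀ l, l ≠ i → l ≠ j → dist (A i) (A j) < dist (A i) (A l)) → f i = j := by
  have hne : ∀ i : Fin n, (Finset.univ.erase i).Nonempty := fun i => by
    rw [← Finset.card_pos, Finset.card_erase_of_mem (Finset.mem_univ i)]
    simp only [Finset.card_univ, Fintype.card_fin]
    omega
  choose f hf hf' using fun i => Finset.exists_min_image _ (fun j => dist (A i) (A j)) (hne i)
  choose g hg hg' using fun i => Finset.exists_max_image _ (fun j => dist (A i) (A j)) (hne i)
  simp only [Finset.mem_erase, Finset.mem_univ, and_true] at hf hf' hg hg'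
  have key : ∀ i j l : Fin n, j ≠ i → l ≠ i → j ≠ l → dist (A i) (A j) ≠ dist (A i) (A l) := by
    intro i j l hj hl hjl h
    rcases Sym2.eq_iff.1 (hA i j i l hj.symm hl.symm h) with h | h
    · exact hjl h.2
    · exact hl h.1.symm
  refine ⟨f, g, ⟨hf, hg, A, hA, fun i j hj hjf => ?_, fun i j hj hjg => ?_⟩, fun i j hj h => ?_⟩
  · exact lt_of_le_of_ne (hf' i j hj) (key i _ _ (hf i) hj hjf.symm)
  · exact lt_of_le_of_ne (hg' i j hj) (key i _ _ hj (hg i) hjg)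
  · by_contra hne
    exact absurd (h (f i) (hf i) hne) (not_lt.2 (hf' i j hj))

/-- There is a realizable pair in which one point is nearest to all the others. -/
theorem exists_realizable_star {n : ℕ} (hn : 3 ≤ n) (o : Fin n) :
    ∃ f g : Fin n → Fin n, Realizable f g ∧ ∀ i, i ≠ o → f i = o := by
  have : Nonempty (Fin n) := ⟨o⟩
  -- Distance 1 to the centre against √2 between the others: a strict gap, which survives
  -- perturbation.
  let A : Fin n → EuclideanSpace ℝ (Fin n) := fun i =>
    if i = o then 0 else EuclideanSpace.single i 1
  let U : Set (Fin n → EuclideanSpace ℝ (Fin n)) :=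
    {A | ∀ i j : Fin n, i ≠ o → j ≠ i → j ≠ o → dist (A i) (A o) < dist (A i) (A j)}
  have hU : IsOpen U := by
    simp only [U, ofPred_forall]
    exact isOpen_iInter_of_finite fun i => isOpen_iInter_of_finite fun j =>
      isOpen_iInter_of_finite fun _ => isOpen_iInter_of_finite fun _ =>
        isOpen_iInter_of_finite fun _ => isOpen_lt (by fun_prop) (by fun_prop)
  have hAU : A ∈ U := by
    intro i j hi hji hj
    have h1 : inner ℝ (EuclideanSpace.single i (1 : ℝ)) (EuclideanSpace.single j (1 : ℝ)) = 0 := by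
      simp [EuclideanSpace.inner_single_left, hji]
    simp only [A, if_neg hi, if_neg hj, if_true, dist_zero_right]
    rw [dist_eq_norm, ← sq_lt_sq₀ (norm_nonneg _) (norm_nonneg _), norm_sub_sq_real, h1]
    simp
  obtain ⟨B, hBU, hB⟩ := (dense_distinctDists n).inter_open_nonempty U hU ⟨A, hAU⟩
  obtain ⟨f, g, hfg, h⟩ := exists_nearest_farthest (by omega) B hB
  exact ⟨f, g, hfg.realizable, fun i hi => h i o hi.symm fun l hl hlo => hBU i l hi hl hlo⟩

/-- The angle opposite the longest side of a triangle is at least 60°, so the cosine is at most 1/2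
and the unit vectors are at least 1 apart. -/
theorem one_le_norm_normalize_sub {E : Type*} [NormedAddCommGroup E] [InnerProductSpace ℝ E]
    {x y : E} (hx : x ≠ 0) (hy : y ≠ 0) (h1 : ‖x‖ ≤ ‖x - y‖) (h2 : ‖y‖ ≤ ‖x - y‖) :
    1 ≤ ‖‖x‖⁻¹ • x - ‖y‖⁻¹ • y‖ := by
  have hx' := norm_pos_iff.2 hx
  have hy' := norm_pos_iff.2 hy
  have h3 : 2 * inner ℝ x y ≤ ‖x‖ * ‖y‖ := by
    have h := norm_sub_sq_real x y
    have h1' : ‖x‖ ^ 2 ≤ ‖x - y‖ ^ 2 := by gcongr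
    have h2' : ‖y‖ ^ 2 ≤ ‖x - y‖ ^ 2 := by gcongr
    rcases le_total ‖x‖ ‖y‖ with hl | hl <;> nlinarith
  rw [← sq_le_sq₀ zero_le_one (norm_nonneg _), norm_sub_sq_real, norm_smul, norm_smul,
    inner_smul_left, inner_smul_right, norm_inv, norm_inv, norm_norm, norm_norm,
    inv_mul_cancel₀ hx'.ne', inv_mul_cancel₀ hy'.ne']
  have h4 : 2 * (‖x‖⁻¹ * (‖y‖⁻¹ * inner ℝ x y)) ≤ 1 := by
    rw [← mul_assoc ‖x‖⁻¹, ← mul_inv, mul_left_comm, inv_mul_le_iff₀ (by positivity)]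
    linarith
  simp only [RCLike.conj_to_real]
  linarith

theorem le_of_mem_euclideanSizes {k n : ℕ} (h : n ∈ euclideanSizes k) : n ≤ 5 ^ k + 1 := by
  obtain ⟨hn, h⟩ := h
  let o : Fin n := ⟨0, by omega⟩
  obtain ⟨f, g, hfg, hf⟩ := exists_realizable_star hn o
  obtain ⟨-, -, A, hA, hA', -⟩ := h f g hfg
  have hlt : ∀ i j, i ≠ o → j ≠ i → j ≠ o → dist (A i) (A o) < dist (A i) (A j) := by
    intro i j hi hji hj
    have := hA' i j hji (by rwa [hf i hi])
    rwa [hf i hi] at this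
  have hne : ∀ i, i ≠ o → A i - A o ≠ 0 := by
    intro i hi h0
    -- A third point is strictly closer to `A o` than to `A i`, so these two cannot coincide.
    obtain ⟨j, hj⟩ : ∃ j : Fin n, j ∉ ({i, o} : Finset (Fin n)) := by
      by_contra! hc
      have := Finset.card_le_card (fun x _ => hc x : Finset.univ ⊆ ({i, o} : Finset (Fin n)))
      have h2 := Finset.card_le_two (a := i) (b := o)
      simp only [Finset.card_univ, Fintype.card_fin] at this
      omega
    simp only [Finset.mem_insert, Finset.mem_singleton, not_or] at hj
    have := hlt j i hj.2 (Ne.symm hj.1) hi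
    rw [sub_eq_zero.1 h0] at this
    exact lt_irrefl _ this
  let u : Fin n → EuclideanSpace ℝ (Fin k) := fun i => ‖A i - A o‖⁻¹ • (A i - A o)
  have hu : ∀ i j, i ≠ o → j ≠ o → i ≠ j → 1 ≤ ‖u i - u j‖ := by
    intro i j hi hj hij
    have e : A i - A o - (A j - A o) = A i - A j := by abel
    refine one_le_norm_normalize_sub (hne i hi) (hne j hj) ?_ ?_
    · rw [e, ← dist_eq_norm, ← dist_eq_norm]
      exact (hlt i j hi hij.symm hj).le
    · rw [e, ← dist_eq_norm, ← dist_eq_norm, dist_comm (A i)]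
      exact (hlt j i hj hij hi).le
  have hinj : Set.InjOn u (Finset.univ.erase o : Finset (Fin n)) := by
    intro i hi j hj hij
    by_contra hne
    have := hu i j (Finset.ne_of_mem_erase hi) (Finset.ne_of_mem_erase hj) hne
    rw [hij, sub_self, norm_zero] at this
    linarith
  -- A 1-separated set in the ball of radius 2 has at most 5^k points.
  have hcard := Besicovitch.card_le_of_separated ((Finset.univ.erase o).image u) (by
    intro c hc
    obtain ⟨i, hi, rfl⟩ := Finset.mem_image.1 hc
    have := norm_pos_iff.2 (hne i (Finset.ne_of_mem_erase hi))
    simp only [u, norm_smul, norm_inv, norm_norm]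
    rw [inv_mul_cancel₀ this.ne']
    norm_num) (by
    intro c hc d hd hcd
    obtain ⟨i, hi, rfl⟩ := Finset.mem_image.1 hc
    obtain ⟨j, hj, rfl⟩ := Finset.mem_image.1 hd
    exact hu i j (Finset.ne_of_mem_erase hi) (Finset.ne_of_mem_erase hj)
      fun h => hcd (by rw [h]))
  rw [Finset.card_image_of_injOn hinj, Finset.card_erase_of_mem (Finset.mem_univ _),
    finrank_euclideanSpace, Fintype.card_fin, Finset.card_univ, Fintype.card_fin] at hcard
  omega

/-! ### Three points on a line -/

theorem three_mem_euclideanSizes {k : ℕ} (hk : 0 < k) : 3 ∈ euclideanSizes k := by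
  have : NeZero k := ⟨hk.ne'⟩
  refine ⟨le_rfl, ?_⟩
  rintro f g ⟨X, _, hf, hg, A, hA, h1, h2⟩
  obtain ⟨v, hv⟩ := exists_norm_eq (EuclideanSpace ℝ (Fin k)) zero_le_one
  obtain ⟨a, ha⟩ : ∃ a : Fin 3 → ℝ, ∀ i j l, i ≠ j → i ≠ l →
      dist (A i) (A j) < dist (A i) (A l) → |a i - a j| < |a i - a l| := by
    have c1 := dist_comm (A 0) (A 1)
    have c2 := dist_comm (A 1) (A 2)
    have c3 := dist_comm (A 0) (A 2)
    have key : ∀ x y z : ℝ, (dist (A 0) (A 1) < dist (A 0) (A 2) → |x - y| < |x - z|) →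
        (dist (A 0) (A 2) < dist (A 0) (A 1) → |x - z| < |x - y|) →
        (dist (A 0) (A 1) < dist (A 1) (A 2) → |x - y| < |y - z|) →
        (dist (A 1) (A 2) < dist (A 0) (A 1) → |y - z| < |x - y|) →
        (dist (A 0) (A 2) < dist (A 1) (A 2) → |x - z| < |y - z|) →
        (dist (A 1) (A 2) < dist (A 0) (A 2) → |y - z| < |x - z|) →
        ∃ a : Fin 3 → ℝ, ∀ i j l, i ≠ j → i ≠ l →
          dist (A i) (A j) < dist (A i) (A l) → |a i - a j| < |a i - a l| := by
      intro x y z h1 h2 h3 h4 h5 h6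
      refine ⟨![x, y, z], fun i j l hij hil h => ?_⟩
      have d1 := abs_sub_comm x y
      have d2 := abs_sub_comm y z
      have d3 := abs_sub_comm x z
      fin_cases i <;> fin_cases j <;> fin_cases l <;> simp at hij hil h ⊢ <;> grind
    have hne : ∀ i j p q : Fin 3, i ≠ j → p ≠ q → s(i, j) ≠ s(p, q) →
        dist (A i) (A j) ≠ dist (A p) (A q) := fun i j p q h h' h'' e => h'' (hA i j p q h h' e)
    have n1 := hne 0 1 1 2 (by decide) (by decide) (by decide)
    have n2 := hne 0 1 0 2 (by decide) (by decide) (by decide)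
    have n3 := hne 0 2 1 2 (by decide) (by decide) (by decide)
    rcases lt_or_gt_of_ne n1 with n1 | n1 <;> rcases lt_or_gt_of_ne n2 with n2 | n2 <;>
      rcases lt_or_gt_of_ne n3 with n3 | n3
    -- The points 0, 1, -2 have distances 1, 2, 3, and relabelling them gives all six orders. The
    -- remaining two sign patterns are cyclic, hence impossible.
    · apply key 0 1 (-2) <;> intro h <;> first | (exfalso; linarith) | norm_num [abs_lt]
    · apply key 1 0 (-2) <;> intro h <;> first | (exfalso; linarith) | norm_num [abs_lt]
    · apply key 0 (-2) 1 <;> intro h <;> first | (exfalso; linarith) | norm_num [abs_lt]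
    · linarith
    · linarith
    · apply key (-2) 0 1 <;> intro h <;> first | (exfalso; linarith) | norm_num [abs_lt]
    · apply key 1 (-2) 0 <;> intro h <;> first | (exfalso; linarith) | norm_num [abs_lt]
    · apply key (-2) 1 0 <;> intro h <;> first | (exfalso; linarith) | norm_num [abs_lt]
  have hd : ∀ i j l, i ≠ j → i ≠ l → dist (A i) (A j) < dist (A i) (A l) →
      dist (a i • v) (a j • v) < dist (a i • v) (a l • v) := by
    intro i j l hij hil h
    rw [dist_eq_norm, dist_eq_norm, ← sub_smul, ← sub_smul, norm_smul, norm_smul, hv,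
      mul_one, mul_one]
    exact ha i j l hij hil h
  exact RealizableIn.of_strict hf hg (fun i => a i • v)
    (fun i j hj hj' => hd _ _ _ (hf i).symm hj.symm (h1 i j hj hj'))
    (fun i j hj hj' => hd _ _ _ hj.symm (hg i).symm (h2 i j hj hj'))

/-! ### Exponentially many nearly orthogonal vectors -/

/-- The sum of the entries of a sign vector. -/
def signSum {k : ℕ} (x : Fin k → ℤˣ) : ℝ := ∑ i, ((x i : ℤ) : ℝ)

theorem signSum_mul_self {k : ℕ} (x : Fin k → ℤˣ) : signSum (x * x) = k := by
  simp [signSum]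

/-- The sum factors over the coordinates as (2 cosh t)^k, and cosh t ≤ exp(t²/2). -/
theorem sum_exp_signSum_le (k : ℕ) (t : ℝ) :
    ∑ x : Fin k → ℤˣ, Real.exp (t * signSum x) ≤ 2 ^ k * Real.exp (k * (t ^ 2 / 2)) := by
  have h1 : ∑ x : Fin k → ℤˣ, Real.exp (t * signSum x) = (2 * Real.cosh t) ^ k := by
    simp only [signSum, Finset.mul_sum, Real.exp_sum]
    rw [← Fintype.piFinset_univ, ← Finset.prod_univ_sum (fun _ => Finset.univ)
      (fun (_ : Fin k) (u : ℤˣ) => Real.exp (t * ((u : ℤ) : ℝ)))]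
    simp only [Finset.prod_const, Finset.card_univ, Fintype.card_fin]
    congr 1
    rw [Real.cosh_eq]
    have : (Finset.univ : Finset ℤˣ) = {1, -1} := rfl
    rw [this, Finset.sum_pair (by decide)]
    simp
    ring
  rw [h1, mul_pow, Real.exp_nat_mul]
  gcongr
  exact Real.cosh_le_exp_half_sq t

/-- Chernoff bound at t = ε, the minimiser of t²/2 - εt; the sign σ selects the tail. -/
theorem card_lt_signSum_le (k : ℕ) {ε : ℝ} (hε : 0 < ε) (σ : ℝ) (hσ : σ ^ 2 = 1) :
    ((Finset.univ.filter fun x : Fin k → ℤˣ => ε * k < σ * signSum x).card : ℝ) ≤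
      2 ^ k * Real.exp (-(k * (ε ^ 2 / 2))) := by
  have h1 : ((Finset.univ.filter fun x : Fin k → ℤˣ => ε * k < σ * signSum x).card : ℝ) *
      Real.exp (ε * (ε * k)) ≤ 2 ^ k * Real.exp (k * (ε ^ 2 / 2)) := by
    calc _ = ∑ x : Fin k → ℤˣ with ε * k < σ * signSum x, Real.exp (ε * (ε * k)) := by simp
      _ ≤ ∑ x : Fin k → ℤˣ with ε * k < σ * signSum x, Real.exp (ε * σ * signSum x) := by
        refine Finset.sum_le_sum fun x hx => ?_
        have := (Finset.mem_filter.1 hx).2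
        rw [mul_assoc]
        gcongr
      _ ≤ ∑ x : Fin k → ℤˣ, Real.exp (ε * σ * signSum x) :=
        Finset.sum_le_sum_of_subset_of_nonneg (Finset.filter_subset _ _)
          fun _ _ _ => (Real.exp_pos _).le
      _ ≤ _ := by
        have := sum_exp_signSum_le k (ε * σ)
        rwa [mul_pow, hσ, mul_one] at this
  rw [← le_div_iff₀ (Real.exp_pos _), mul_div_assoc, ← Real.exp_sub] at h1
  refine h1.trans_eq ?_
  congr 2
  ring

theorem card_lt_abs_signSum_le (k : ℕ) {ε : ℝ} (hε : 0 < ε) :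
    ((Finset.univ.filter fun x : Fin k → ℤˣ => ε * k < |signSum x|).card : ℝ) ≤
      2 * (2 ^ k * Real.exp (-(k * (ε ^ 2 / 2)))) := by
  have h : (Finset.univ.filter fun x : Fin k → ℤˣ => ε * k < |signSum x|) ⊆
      (Finset.univ.filter fun x : Fin k → ℤˣ => ε * k < 1 * signSum x) ∪
      (Finset.univ.filter fun x : Fin k → ℤˣ => ε * k < (-1) * signSum x) := by
    intro x hx
    simpa [lt_abs] using hx
  have h1 := card_lt_signSum_le k hε 1 (by norm_num)
  have h2 := card_lt_signSum_le k hε (-1) (by norm_num)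
  have h3 : ((Finset.univ.filter fun x : Fin k → ℤˣ => ε * k < |signSum x|).card : ℝ) ≤ _ :=
    Nat.cast_le.2 ((Finset.card_le_card h).trans (Finset.card_union_le _ _))
  push_cast at h3
  linarith

/-- In a family of maximal size, every sign vector is strongly correlated with some member. The sets
of vectors correlated with one member therefore cover the cube, and the tail bound limits the size
of each. -/
theorem exists_signs_small_correlation {k : ℕ} (hk : 0 < k) {ε : ℝ} (hε : 0 < ε) (hε1 : ε < 1) :
    ∃ C : Finset (Fin k → ℤˣ), Real.exp (k * (ε ^ 2 / 2)) / 2 ≤ (C.card : ℝ) ∧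
      ∀ x ∈ C, ∀ y ∈ C, x ≠ y → |signSum (x * y)| ≤ ε * k := by
  classical
  let S : Finset (Finset (Fin k → ℤˣ)) := Finset.univ.filter fun C =>
    ∀ x ∈ C, ∀ y ∈ C, x ≠ y → |signSum (x * y)| ≤ ε * k
  obtain ⟨C, hC, hmax⟩ := Finset.exists_max_image S Finset.card ⟨∅, by simp [S]⟩
  have hC' : ∀ x ∈ C, ∀ y ∈ C, x ≠ y → |signSum (x * y)| ≤ ε * k := (Finset.mem_filter.1 hC).2
  refine ⟨C, ?_, hC'⟩
  let bad : (Fin k → ℤˣ) → Finset (Fin k → ℤˣ) := fun y =>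
    Finset.univ.filter fun x => ε * k < |signSum (x * y)|
  have hk' : (0 : ℝ) < k := Nat.cast_pos.2 hk
  have hcover : Finset.univ ⊆ C.biUnion bad := by
    intro x _
    rw [Finset.mem_biUnion]
    by_contra! hx
    simp only [bad, Finset.mem_filter, Finset.mem_univ, true_and, not_lt] at hx
    have hxC : x ∉ C := by
      intro h
      have := hx x h
      rw [signSum_mul_self, abs_of_pos hk'] at this
      nlinarith
    have hins : insert x C ∈ S := by
      refine Finset.mem_filter.2 ⟨Finset.mem_univ _, fun a ha b hb hab => ?_⟩
      rcases Finset.mem_insert.1 ha with rfl | ha' <;>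
        rcases Finset.mem_insert.1 hb with rfl | hb'
      · exact absurd rfl hab
      · exact hx b hb'
      · rw [mul_comm]
        exact hx a ha'
      · exact hC' a ha' b hb' hab
    have := hmax _ hins
    rw [Finset.card_insert_of_notMem hxC] at this
    omega
  have hbad : ∀ y, ((bad y).card : ℝ) ≤ 2 * (2 ^ k * Real.exp (-(k * (ε ^ 2 / 2)))) := by
    intro y
    refine le_trans (Nat.cast_le.2 ?_) (card_lt_abs_signSum_le k hε)
    -- Multiplication by y reduces the count to the tail of `signSum` itself.
    refine Finset.card_le_card_of_injOn (· * y) (fun x hx => ?_)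
      (mul_left_injective y).injOn
    simpa [bad] using hx
  have hcard : ((2 : ℝ) ^ k) ≤ C.card * (2 * (2 ^ k * Real.exp (-(k * (ε ^ 2 / 2))))) := by
    have h1 : ((Finset.univ : Finset (Fin k → ℤˣ)).card : ℝ) ≤ ∑ y ∈ C, ((bad y).card : ℝ) := by
      exact_mod_cast (Finset.card_le_card hcover).trans Finset.card_biUnion_le
    have h2 := h1.trans (Finset.sum_le_card_nsmul C _ _ fun y _ => hbad y)
    simpa using h2
  have h2 : (0 : ℝ) < 2 ^ k := by positivity
  rw [Real.exp_neg] at hcard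
  have h3 := Real.exp_pos (k * (ε ^ 2 / 2))
  have h4 : (2 : ℝ) ^ k * 1 ≤ 2 ^ k * (C.card * 2 * (Real.exp (k * (ε ^ 2 / 2)))⁻¹) := by linarith
  have h5 := le_of_mul_le_mul_left h4 h2
  rw [← div_eq_mul_inv, le_div_iff₀ h3] at h5
  linarith

/-- Euclidean space contains exponentially many nearly orthogonal unit vectors. -/
theorem exists_nearly_orthonormal {k : ℕ} (hk : 0 < k) {ε : ℝ} (hε : 0 < ε) (hε1 : ε < 1) :
    ∃ n : ℕ, Real.exp (k * (ε ^ 2 / 2)) / 2 ≤ n ∧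
      ∃ e : Fin n → EuclideanSpace ℝ (Fin k), (∀ i, ‖e i‖ = 1) ∧
        ∀ i j, i ≠ j → |inner ℝ (e i) (e j)| ≤ ε := by
  obtain ⟨C, hC, hC'⟩ := exists_signs_small_correlation hk hε hε1
  have hk' : (0 : ℝ) < k := Nat.cast_pos.2 hk
  let v : (Fin k → ℤˣ) → EuclideanSpace ℝ (Fin k) := fun x =>
    (Real.sqrt k)⁻¹ • WithLp.toLp 2 fun i => ((x i : ℤ) : ℝ)
  have hv : ∀ x y, inner ℝ (v x) (v y) = signSum (x * y) / k := by
    intro x y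
    have : inner ℝ (WithLp.toLp 2 fun i => ((x i : ℤ) : ℝ) : EuclideanSpace ℝ (Fin k))
        (WithLp.toLp 2 fun i => ((y i : ℤ) : ℝ)) = signSum (x * y) := by
      simp [PiLp.inner_apply, signSum, mul_comm]
    simp only [v, inner_smul_left, inner_smul_right, this, RCLike.conj_to_real]
    rw [← mul_assoc, ← mul_inv, Real.mul_self_sqrt hk'.le, inv_mul_eq_div]
  refine ⟨C.card, hC, fun i => v (C.equivFin.symm i), fun i => ?_, fun i j hij => ?_⟩
  · have h := real_inner_self_eq_norm_sq (v (C.equivFin.symm i))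
    rw [hv, signSum_mul_self, div_self hk'.ne'] at h
    exact (pow_eq_one_iff_of_nonneg (norm_nonneg _) two_ne_zero).1 h.symm
  · rw [hv, abs_div, abs_of_pos hk', div_le_iff₀ hk']
    exact hC' _ (C.equivFin.symm i).2 _ (C.equivFin.symm j).2
      fun h => hij (C.equivFin.symm.injective (Subtype.ext h))

/-! ### Prescribing squared distances on sparse pairs -/

section Tuning

variable {E : Type*} [NormedAddCommGroup E] [InnerProductSpace ℝ E] {n : ℕ}

/-- The combination of the vectors `e j`, `j ∈ T i`, with the coefficients `w i j`. -/
def sparseComb (e : Fin n → E) (T : Fin n → Finset (Fin n)) (w : Fin n → Fin n → ℝ)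
    (i : Fin n) : E :=
  ∑ j ∈ T i, w i j • e j

theorem sparseComb_sub (e : Fin n → E) (T : Fin n → Finset (Fin n)) (w w' : Fin n → Fin n → ℝ)
    (i : Fin n) :
    sparseComb e T w i - sparseComb e T w' i = sparseComb e T (w - w') i := by
  simp [sparseComb, ← Finset.sum_sub_distrib, sub_smul]

theorem abs_apply_le_norm (w : Fin n → Fin n → ℝ) (i j : Fin n) : |w i j| ≤ ‖w‖ :=
  (norm_le_pi_norm (w i) j).trans (norm_le_pi_norm w i)

theorem norm_sparseComb_le {e : Fin n → E} {T : Fin n → Finset (Fin n)} (he : ∀ i, ‖e i‖ = 1)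
    (hT : ∀ i, (T i).card ≤ 3) (w : Fin n → Fin n → ℝ) (i : Fin n) :
    ‖sparseComb e T w i‖ ≤ 3 * ‖w‖ := by
  calc ‖sparseComb e T w i‖ ≤ ∑ j ∈ T i, ‖w i j • e j‖ := norm_sum_le _ _
    _ ≤ (T i).card • ‖w‖ := by
      refine Finset.sum_le_card_nsmul _ _ _ fun j _ => ?_
      rw [norm_smul, he, mul_one]
      exact abs_apply_le_norm w i j
    _ ≤ 3 * ‖w‖ := by
      rw [nsmul_eq_mul]
      gcongr
      exact_mod_cast hT i

theorem abs_inner_sparseComb_le {e : Fin n → E} {T : Fin n → Finset (Fin n)} {ε : ℝ}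
    (hε : 0 ≤ ε) (hee : ∀ i j, i ≠ j → |inner ℝ (e i) (e j)| ≤ ε)
    (hT : ∀ i, (T i).card ≤ 3) (w : Fin n → Fin n → ℝ) {i l : Fin n} (hl : l ∉ T i) :
    |inner ℝ (sparseComb e T w i) (e l)| ≤ 3 * (ε * ‖w‖) := by
  rw [sparseComb, sum_inner]
  calc _ ≤ ∑ j ∈ T i, |inner ℝ (w i j • e j) (e l)| := Finset.abs_sum_le_sum_abs _ _
    _ ≤ (T i).card • (ε * ‖w‖) := by
      refine Finset.sum_le_card_nsmul _ _ _ fun j hj => ?_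
      rw [real_inner_smul_left, abs_mul, mul_comm]
      exact mul_le_mul (hee j l fun h => hl (h ▸ hj)) (abs_apply_le_norm w i j) (abs_nonneg _) hε
    _ ≤ 3 * (ε * ‖w‖) := by
      rw [nsmul_eq_mul]
      gcongr
      exact_mod_cast hT i

theorem abs_inner_sparseComb_sub_le {e : Fin n → E} {T : Fin n → Finset (Fin n)} {ε : ℝ}
    (hε : 0 ≤ ε) (he : ∀ i, ‖e i‖ = 1) (hee : ∀ i j, i ≠ j → |inner ℝ (e i) (e j)| ≤ ε)
    (hT : ∀ i, (T i).card ≤ 3) (w : Fin n → Fin n → ℝ) {i l : Fin n} (hl : l ∈ T i) :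
    |inner ℝ (sparseComb e T w i) (e l) - w i l| ≤ 3 * (ε * ‖w‖) := by
  let T' : Fin n → Finset (Fin n) := fun i => (T i).erase l
  have h : sparseComb e T w i = w i l • e l + sparseComb e T' w i :=
    (Finset.add_sum_erase _ _ hl).symm
  rw [h, inner_add_left, real_inner_smul_left, real_inner_self_eq_norm_sq, he, one_pow, mul_one,
    add_sub_cancel_left]
  exact abs_inner_sparseComb_le hε hee (fun i => (Finset.card_erase_le).trans (hT i)) w
    (Finset.notMem_erase l (T i))

/-- The linear part of the change of the squared distances is nearly diagonal. -/
theorem abs_inner_sub_sparseComb_sub_le {e : Fin n → E} {T : Fin n → Finset (Fin n)} {ε : ℝ}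
    (hε : 0 ≤ ε) (he : ∀ i, ‖e i‖ = 1) (hee : ∀ i j, i ≠ j → |inner ℝ (e i) (e j)| ≤ ε)
    (hT : ∀ i, (T i).card ≤ 3) (hTi : ∀ i, i ∉ T i) (w : Fin n → Fin n → ℝ) {i j : Fin n}
    (hji : i ∉ T j) :
    |inner ℝ (sparseComb e T w i - sparseComb e T w j) (e i - e j) +
      (if j ∈ T i then w i j else 0)| ≤ 12 * (ε * ‖w‖) := by
  have h1 := abs_le.1 (abs_inner_sparseComb_le hε hee hT w (hTi i))
  have h2 := abs_le.1 (abs_inner_sparseComb_le hε hee hT w (hTi j))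
  have h3 := abs_le.1 (abs_inner_sparseComb_le hε hee hT w hji)
  -- Of the four inner products only this one can have a main term, and it enters with a minus sign;
  -- each has error 3ε‖w‖.
  have h4 : |inner ℝ (sparseComb e T w i) (e j) - (if j ∈ T i then w i j else 0)| ≤
      3 * (ε * ‖w‖) := by
    split_ifs with h
    · exact abs_inner_sparseComb_sub_le hε he hee hT w h
    · rw [sub_zero]
      exact abs_inner_sparseComb_le hε hee hT w h
  have h4 := abs_le.1 h4
  rw [inner_sub_left, inner_sub_right, inner_sub_right, abs_le]
  constructor <;> linarith [h1.1, h1.2, h2.1, h2.2, h3.1, h3.2, h4.1, h4.2]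

theorem norm_sparseComb_sub_le {e : Fin n → E} {T : Fin n → Finset (Fin n)} (he : ∀ i, ‖e i‖ = 1)
    (hT : ∀ i, (T i).card ≤ 3) (w : Fin n → Fin n → ℝ) (i j : Fin n) :
    ‖sparseComb e T w i - sparseComb e T w j‖ ≤ 6 * ‖w‖ := by
  linarith [norm_sub_le (sparseComb e T w i) (sparseComb e T w j), norm_sparseComb_le he hT w i,
    norm_sparseComb_le he hT w j]

/-- The squared distance between the points `e i + sparseComb e T w i`. -/
def tunedSq (e : Fin n → E) (T : Fin n → Finset (Fin n)) (w : Fin n → Fin n → ℝ)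
    (i j : Fin n) : ℝ :=
  ‖(e i + sparseComb e T w i) - (e j + sparseComb e T w j)‖ ^ 2

/-- By ‖x‖² - ‖y‖² = ⟨x - y, x + y⟩ the change has a linear part, with error 24ε, and a quadratic
part, bounded through 6 · 12R = 72R. -/
theorem abs_tunedSq_sub_le {e : Fin n → E} {T : Fin n → Finset (Fin n)} {ε R : ℝ}
    (hε : 0 ≤ ε) (he : ∀ i, ‖e i‖ = 1) (hee : ∀ i j, i ≠ j → |inner ℝ (e i) (e j)| ≤ ε)
    (hT : ∀ i, (T i).card ≤ 3) (hTi : ∀ i, i ∉ T i) {w w' : Fin n → Fin n → ℝ}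
    (hw : ‖w‖ ≤ R) (hw' : ‖w'‖ ≤ R) {i j : Fin n} (hji : i ∉ T j) :
    |tunedSq e T w i j - tunedSq e T w' i j + 2 * (if j ∈ T i then (w - w') i j else 0)| ≤
      (24 * ε + 72 * R) * ‖w - w'‖ := by
  have hp := sparseComb_sub e T w w'
  set p := sparseComb e T w with hpdef
  set p' := sparseComb e T w' with hpdef'
  set q := sparseComb e T (w - w') with hqdef
  have h1 := abs_inner_sub_sparseComb_sub_le hε he hee hT hTi (w - w') hji
  rw [← hqdef] at h1
  have h2 : |inner ℝ (q i - q j) ((p i - p j) + (p' i - p' j))| ≤ 72 * R * ‖w - w'‖ := by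
    refine (abs_real_inner_le_norm _ _).trans ?_
    have a1 : ‖q i - q j‖ ≤ 6 * ‖w - w'‖ := norm_sparseComb_sub_le he hT _ _ _
    have a2 : ‖p i - p j‖ ≤ 6 * ‖w‖ := norm_sparseComb_sub_le he hT _ _ _
    have a3 : ‖p' i - p' j‖ ≤ 6 * ‖w'‖ := norm_sparseComb_sub_le he hT _ _ _
    have a4 := norm_add_le (p i - p j) (p' i - p' j)
    calc _ ≤ (6 * ‖w - w'‖) * (12 * R) := by gcongr; linarith
      _ = _ := by ring
  have h3 : tunedSq e T w i j - tunedSq e T w' i j =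
      2 * inner ℝ (q i - q j) (e i - e j) +
        inner ℝ (q i - q j) ((p i - p j) + (p' i - p' j)) := by
    have : ∀ x y : E, ‖x‖ ^ 2 - ‖y‖ ^ 2 = inner ℝ (x - y) (x + y) := by
      intro x y
      rw [inner_sub_left, inner_add_right, inner_add_right, real_inner_self_eq_norm_sq,
        real_inner_self_eq_norm_sq, real_inner_comm x y]
      ring
    rw [tunedSq, tunedSq, this, ← hpdef, ← hpdef', ← hp, ← hp, ← real_inner_smul_right,
      ← inner_add_right]
    congr 1
    · abel
    · rw [two_smul]
      abel
  rw [h3]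
  have h1 := abs_le.1 h1
  have h2 := abs_le.1 h2
  rw [abs_le]
  constructor <;> linarith [h1.1, h1.2, h2.1, h2.2]

theorem tunedSq_zero {e : Fin n → E} {T : Fin n → Finset (Fin n)} (he : ∀ i, ‖e i‖ = 1)
    (i j : Fin n) : tunedSq e T 0 i j = 2 - 2 * inner ℝ (e i) (e j) := by
  simp only [tunedSq, sparseComb, Pi.zero_apply, zero_smul, Finset.sum_const_zero, add_zero]
  rw [norm_sub_sq_real, he, he]
  ring

/-- The squared distances along a sparse set of pairs can be prescribed exactly, while the other
ones stay close to `2`. -/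
theorem exists_tuned_oriented {e : Fin n → E} (he : ∀ i, ‖e i‖ = 1)
    (hee : ∀ i j, i ≠ j → |inner ℝ (e i) (e j)| ≤ 1 / 1000000)
    {T : Fin n → Finset (Fin n)} (hT : ∀ i, (T i).card ≤ 3) (hTi : ∀ i, i ∉ T i)
    (hTT : ∀ i j, j ∈ T i → i ∉ T j) {τ : Fin n → Fin n → ℝ}
    (hτ : ∀ i j, |τ i j - 2| ≤ 1 / 10000) :
    ∃ A : Fin n → E, (∀ i j, j ∈ T i → ‖A i - A j‖ ^ 2 = τ i j) ∧
      ∀ i j, i ≠ j → j ∉ T i → i ∉ T j → |‖A i - A j‖ ^ 2 - 2| ≤ 1 / 100000 := by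
  -- Newton iteration with the derivative replaced by -2 times the identity: a fixed point has the
  -- required values on `T`.
  let Φ : (Fin n → Fin n → ℝ) → Fin n → Fin n → ℝ := fun w i j =>
    if j ∈ T i then w i j + (tunedSq e T w i j - τ i j) / 2 else 0
  -- The radius R fits both needs: 12ε + 36R ≤ 1/2 gives the contraction, and R/2 + ‖Φ 0‖ ≤ R keeps
  -- the ball invariant.
  let s : Set (Fin n → Fin n → ℝ) := Metric.closedBall 0 (2 / 10000)
  have hlip : ∀ w ∈ s, ∀ w' ∈ s, ‖Φ w - Φ w'‖ ≤ 1 / 2 * ‖w - w'‖ := by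
    intro w hw w' hw'
    rw [mem_closedBall_zero_iff] at hw hw'
    have h0 : 0 ≤ 1 / 2 * ‖w - w'‖ := by positivity
    rw [pi_norm_le_iff_of_nonneg h0]
    intro i
    rw [pi_norm_le_iff_of_nonneg h0]
    intro j
    simp only [Pi.sub_apply, Φ]
    split_ifs with h
    · have := abs_tunedSq_sub_le (by norm_num) he hee hT hTi hw hw' (hTT i j h)
      rw [if_pos h] at this
      simp only [Pi.sub_apply] at this
      have := abs_le.1 this
      rw [Real.norm_eq_abs, abs_le]
      constructor <;> linarith [this.1, this.2, norm_nonneg (w - w')]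
    · simp
  have hΦ0 : ‖Φ 0‖ ≤ 1 / 10000 := by
    rw [pi_norm_le_iff_of_nonneg (by norm_num)]
    intro i
    rw [pi_norm_le_iff_of_nonneg (by norm_num)]
    intro j
    simp only [Φ]
    split_ifs with h
    · have h1 := abs_le.1 (hee i j fun hij => hTi i (by rwa [← hij] at h))
      have h2 := abs_le.1 (hτ i j)
      rw [tunedSq_zero he, Real.norm_eq_abs, abs_le]
      simp only [Pi.zero_apply]
      constructor <;> linarith [h1.1, h1.2, h2.1, h2.2]
    · norm_num
  have hzero : (0 : Fin n → Fin n → ℝ) ∈ s := Metric.mem_closedBall_self (by norm_num)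
  have hmaps : MapsTo Φ s s := by
    intro w hw
    have h1 := hlip w hw 0 hzero
    have h2 := norm_add_le (Φ w - Φ 0) (Φ 0)
    rw [sub_add_cancel] at h2
    rw [sub_zero] at h1
    rw [mem_closedBall_zero_iff] at hw ⊢
    linarith
  have hcontr : ContractingWith (1 / 2) (hmaps.restrict Φ s s) := by
    refine ⟨by norm_num, LipschitzWith.of_dist_le_mul fun w w' => ?_⟩
    have := hlip w w.2 w' w'.2
    simpa [Subtype.dist_eq, dist_eq_norm] using this
  obtain ⟨w, hw, hfix, -⟩ := hcontr.exists_fixedPoint' Metric.isClosed_closedBall.isComplete hmaps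
    hzero (edist_ne_top _ _)
  refine ⟨fun i => e i + sparseComb e T w i, fun i j hij => ?_, fun i j hij h1 h2 => ?_⟩
  · have := congrFun (congrFun hfix i) j
    simp only [Φ, if_pos hij] at this
    change tunedSq e T w i j = τ i j
    linarith
  · rw [mem_closedBall_zero_iff] at hw
    have h3 := abs_le.1 (hee i j hij)
    -- Comparison with w = 0: the total deviation is at most (24ε + 72R)R + 2ε < 1/100000.
    have h4 : ‖(0 : Fin n → Fin n → ℝ)‖ ≤ 2 / 10000 := by norm_num
    have := abs_tunedSq_sub_le (by norm_num) he hee hT hTi hw h4 h2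
    rw [if_neg h1, tunedSq_zero he, sub_zero] at this
    have := abs_le.1 this
    change |tunedSq e T w i j - 2| ≤ _
    rw [abs_le]
    constructor <;> linarith [this.1, this.2, h3.1, h3.2]

/-- Each pair is oriented exactly once, from the smaller index when both orientations occur, so that
a single coefficient controls it. -/
theorem exists_tuned {e : Fin n → E} (he : ∀ i, ‖e i‖ = 1)
    (hee : ∀ i j, i ≠ j → |inner ℝ (e i) (e j)| ≤ 1 / 1000000)
    {Q : Fin n → Finset (Fin n)} (hQ : ∀ i, (Q i).card ≤ 3) {τ : Fin n → Fin n → ℝ}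
    (hτ : ∀ i j, |τ i j - 2| ≤ 1 / 10000) (hsymm : ∀ i j, τ i j = τ j i) :
    ∃ A : Fin n → E, (∀ i j, i ≠ j → j ∈ Q i ∨ i ∈ Q j → ‖A i - A j‖ ^ 2 = τ i j) ∧
      ∀ i j, i ≠ j → j ∉ Q i → i ∉ Q j → |‖A i - A j‖ ^ 2 - 2| ≤ 1 / 100000 := by
  let T : Fin n → Finset (Fin n) := fun i => (Q i).filter fun j => j ≠ i ∧ (i ∈ Q j → i < j)
  have hmem : ∀ i j, j ∈ T i ↔ j ∈ Q i ∧ j ≠ i ∧ (i ∈ Q j → i < j) := fun i j =>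
    Finset.mem_filter
  obtain ⟨A, hA, hA'⟩ := exists_tuned_oriented he hee (T := T)
    (fun i => (Finset.card_filter_le _ _).trans (hQ i)) (fun i h => ((hmem i i).1 h).2.1 rfl)
    (fun i j h h' => by
      obtain ⟨a, -, b⟩ := (hmem i j).1 h
      obtain ⟨a', -, b'⟩ := (hmem j i).1 h'
      exact lt_asymm (b a') (b' a)) hτ
  refine ⟨A, fun i j hij h => ?_, fun i j hij h1 h2 => hA' i j hij
    (fun h => h1 ((hmem i j).1 h).1) (fun h => h2 ((hmem j i).1 h).1)⟩
  have : j ∈ T i ∨ i ∈ T j := by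
    rw [hmem, hmem]
    rcases lt_or_gt_of_ne hij with hlt | hlt
    · by_cases hj : j ∈ Q i
      · exact Or.inl ⟨hj, hij.symm, fun _ => hlt⟩
      · exact Or.inr ⟨h.resolve_left hj, hij, fun h => absurd h hj⟩
    · by_cases hi : i ∈ Q j
      · exact Or.inr ⟨hi, hij, fun _ => hlt⟩
      · exact Or.inl ⟨h.resolve_right hi, hij.symm, fun h => absurd h hi⟩
  rcases this with h | h
  · exact hA i j h
  · rw [norm_sub_rev, hsymm]
    exact hA j i h

end Tuning

/-! ### Pairs that are both nearest and farthest -/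

section Combinatorics

variable {n : ℕ} {f g : Fin n → Fin n} {D : Fin n → Fin n → ℝ}

/-- `f i` is the strictly nearest and `g i` the strictly farthest point from `i` with respect to the
symmetric function `D`. -/
structure NearestFarthest (D : Fin n → Fin n → ℝ) (f g : Fin n → Fin n) : Prop where
  symm : ∀ i j, D i j = D j i
  near_ne : ∀ i, f i ≠ i
  far_ne : ∀ i, g i ≠ i
  near_ne_far : ∀ i, f i ≠ g i
  near : ∀ i j, j ≠ i → j ≠ f i → D i (f i) < D i j
  far : ∀ i j, j ≠ i → j ≠ g i → D i j < D i (g i)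

namespace NearestFarthest

theorem of_three_le (hn : 3 ≤ n) (symm : ∀ i j, D i j = D j i) (hf : ∀ i, f i ≠ i)
    (hg : ∀ i, g i ≠ i) (near : ∀ i j, j ≠ i → j ≠ f i → D i (f i) < D i j)
    (far : ∀ i j, j ≠ i → j ≠ g i → D i j < D i (g i)) : NearestFarthest D f g := by
  refine ⟨symm, hf, hg, fun i h => ?_, near, far⟩
  obtain ⟨j, hj⟩ : ∃ j : Fin n, j ∉ ({i, f i} : Finset (Fin n)) := by
    by_contra! hc
    have := Finset.card_le_card (fun x _ => hc x : Finset.univ ⊆ ({i, f i} : Finset (Fin n)))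
    have h2 := Finset.card_le_two (a := i) (b := f i)
    simp only [Finset.card_univ, Fintype.card_fin] at this
    omega
  simp only [Finset.mem_insert, Finset.mem_singleton, not_or] at hj
  have h1 := near i j hj.1 hj.2
  have h2 := far i j hj.1 (h ▸ hj.2)
  rw [h] at h1
  exact lt_asymm h1 h2

variable (h : NearestFarthest D f g)
include h

/-- With b = f a, f j = a would give the cycle D j a < D j b < D b a < D a j. -/
theorem near_ne_of_far_near {a : Fin n} (ha : g (f a) = a) (j : Fin n) : f j ≠ a := by
  intro hj
  have hjf : j ≠ f a := by
    rintro rfl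
    exact h.near_ne_far (f a) (hj.trans ha.symm)
  have hja : j ≠ a := by
    rintro rfl
    exact h.near_ne _ hj
  have h1 := h.near j (f a) hjf.symm (by rw [hj]; exact h.near_ne a)
  have h2 := h.far (f a) j hjf (by rwa [ha])
  have h3 := h.near a j hja hjf
  rw [hj] at h1
  rw [ha] at h2
  linarith [h.symm j a, h.symm j (f a), h.symm a (f a)]

/-- The same cycle arises: D j a < D j b < D b a < D a j, where b = f a. -/
theorem far_ne_near_of_far_near {a : Fin n} (ha : g (f a) = a) (j : Fin n) : g j ≠ f a := by
  intro hj
  have hja : j ≠ a := by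
    rintro rfl
    exact h.near_ne_far _ hj.symm
  have hjf : j ≠ f a := by
    rintro rfl
    exact h.far_ne _ hj
  have h1 := h.far j a hja.symm (by rw [hj]; exact (h.near_ne a).symm)
  have h2 := h.near a j hja hjf
  have h3 := h.far (f a) j hjf (by rwa [ha])
  rw [hj] at h1
  rw [ha] at h3
  linarith [h.symm j a, h.symm j (f a), h.symm a (f a)]

/-- With b = f a and c = f j, two such points would give D j c < D j b < D a b < D a c < D j c. -/
theorem far_near_unique {a j : Fin n} (ha : g (f a) = a) (hj : g (f j) = j) : j = a := by
  by_contra hja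
  have hjb : j ≠ f a := by
    rintro rfl
    exact h.far_ne_near_of_far_near ha _ hj
  have hcb : f j ≠ f a := fun hc => hja (by rw [← hj, hc, ha])
  have hca := h.near_ne_of_far_near ha j
  have h1 := h.near j (f a) hjb.symm hcb.symm
  have h2 := h.far (f j) a hca.symm (by rw [hj]; exact Ne.symm hja)
  have h3 := h.near a (f j) hca hcb
  have h4 := h.far (f a) j hjb (by rwa [ha])
  rw [hj] at h2
  rw [ha] at h4
  linarith [h.symm j (f a), h.symm j (f j), h.symm a (f j), h.symm a (f a)]

end NearestFarthest

/-- The prescribed squared distances, close to `2`. They are small on the pairs `{i, f i}`, large on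
the pairs `{i, g i}`, and increasing in `D` on both; a pair of both kinds gets an intermediate value,
just below that of the other pairs at its end `i` with `g (f i) = i`. -/
noncomputable def targetSq (D : Fin n → Fin n → ℝ) (f g : Fin n → Fin n) (i j : Fin n) : ℝ :=
  -- Offsets from 2 in units of 1/100000: nearest pairs in [-10, -5), ordinary pairs later kept in
  -- [-1, 1], the double pair 2, other pairs at its end 3, farthest pairs in [5, 10). The increasing
  -- map x/(1+x) squeezes `D` into [0, 1).
  if f i = j ∨ f j = i then
    if g i = j ∨ g j = i then 2 + 2 / 100000
    else 2 - 10 / 100000 + 5 / 100000 * (D i j / (1 + D i j))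
  else if g i = j ∨ g j = i then 2 + 5 / 100000 + 5 / 100000 * (D i j / (1 + D i j))
  else if g (f i) = i ∨ g (f j) = j then 2 + 3 / 100000 else 2

theorem targetSq_symm (hD : ∀ i j, D i j = D j i) (i j : Fin n) :
    targetSq D f g i j = targetSq D f g j i := by
  simp only [targetSq, hD j i, or_comm]

theorem div_one_add_nonneg {x : ℝ} (hx : 0 ≤ x) : 0 ≤ x / (1 + x) := by positivity

theorem div_one_add_lt_one {x : ℝ} (hx : 0 ≤ x) : x / (1 + x) < 1 := by
  rw [div_lt_one (by positivity)]
  linarith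

theorem div_one_add_lt {x y : ℝ} (hx : 0 ≤ x) (h : x < y) : x / (1 + x) < y / (1 + y) := by
  rw [div_lt_div_iff₀ (by positivity) (by linarith)]
  linarith

theorem abs_targetSq_sub_le (hD : ∀ i j, 0 ≤ D i j) (i j : Fin n) :
    |targetSq D f g i j - 2| ≤ 1 / 10000 := by
  have h1 := div_one_add_nonneg (hD i j)
  have h2 := div_one_add_lt_one (hD i j)
  rw [targetSq, abs_le]
  split_ifs <;> constructor <;> linarith

/-- An array that agrees with `targetSq` on the exceptional pairs and is close to `2` on the
others has the same nearest and farthest points as `D`. -/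
theorem NearestFarthest.of_near_targetSq (h : NearestFarthest D f g) (hD : ∀ i j, 0 ≤ D i j)
    {N : Fin n → Fin n → ℝ}
    (hN : ∀ i j, i ≠ j → (f i = j ∨ f j = i) ∨ (g i = j ∨ g j = i) ∨
      (g (f i) = i ∨ g (f j) = j) → N i j = targetSq D f g i j)
    (hN' : ∀ i j, i ≠ j → ¬ (f i = j ∨ f j = i) → ¬ (g i = j ∨ g j = i) →
      ¬ (g (f i) = i ∨ g (f j) = j) → |N i j - 2| ≤ 1 / 100000) :
    (∀ i j, j ≠ i → j ≠ f i → N i (f i) < N i j) ∧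
      ∀ i j, j ≠ i → j ≠ g i → N i j < N i (g i) := by
  have hθ0 : ∀ i j, 0 ≤ D i j / (1 + D i j) := fun i j => div_one_add_nonneg (hD i j)
  have hθ1 : ∀ i j, D i j / (1 + D i j) < 1 := fun i j => div_one_add_lt_one (hD i j)
  have hFG : ∀ i j, i ≠ j → (f i = j ∨ f j = i) → (g i = j ∨ g j = i) →
      N i j = 2 + 2 / 100000 := fun i j hij hF hG => by
    rw [hN i j hij (Or.inl hF), targetSq, if_pos hF, if_pos hG]
  have hF : ∀ i j, i ≠ j → (f i = j ∨ f j = i) → ¬ (g i = j ∨ g j = i) →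
      N i j = 2 - 10 / 100000 + 5 / 100000 * (D i j / (1 + D i j)) := fun i j hij hF hG => by
    rw [hN i j hij (Or.inl hF), targetSq, if_pos hF, if_neg hG]
  have hG : ∀ i j, i ≠ j → ¬ (f i = j ∨ f j = i) → (g i = j ∨ g j = i) →
      N i j = 2 + 5 / 100000 + 5 / 100000 * (D i j / (1 + D i j)) := fun i j hij hF hG => by
    rw [hN i j hij (Or.inr (Or.inl hG)), targetSq, if_neg hF, if_pos hG]
  have hS : ∀ i j, i ≠ j → ¬ (f i = j ∨ f j = i) → ¬ (g i = j ∨ g j = i) →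
      (g (f i) = i ∨ g (f j) = j) → N i j = 2 + 3 / 100000 := fun i j hij hF hG hS => by
    rw [hN i j hij (Or.inr (Or.inr hS)), targetSq, if_neg hF, if_neg hG, if_pos hS]
  constructor
  · intro i j hji hjf
    -- If i is exceptional, no other nearest pair meets i, so all its other values are at least
    -- offset 3, above the 2 of the double pair.
    by_cases hi : g (f i) = i
    · rw [hFG i (f i) (h.near_ne i).symm (Or.inl rfl) (Or.inr hi)]
      have hnF : ¬ (f i = j ∨ f j = i) := by
        rintro (h1 | h1)
        · exact hjf h1.symm
        · exact h.near_ne_of_far_near hi j h1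
      by_cases hjG : g i = j ∨ g j = i
      · rw [hG i j hji.symm hnF hjG]
        linarith [hθ0 i j]
      · rw [hS i j hji.symm hnF hjG (Or.inl hi)]
        linarith
    · have hnG : ¬ (g i = f i ∨ g (f i) = i) := by
        rintro (h1 | h1)
        · exact h.near_ne_far i h1.symm
        · exact hi h1
      rw [hF i (f i) (h.near_ne i).symm (Or.inl rfl) hnG]
      have h1 := hθ1 i (f i)
      have h0 := hθ0 i j
      by_cases hjF : f i = j ∨ f j = i <;> by_cases hjG : g i = j ∨ g j = i
      · rw [hFG i j hji.symm hjF hjG]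
        linarith
      · rw [hF i j hji.symm hjF hjG]
        linarith [div_one_add_lt (hD i (f i)) (h.near i j hji hjf)]
      · rw [hG i j hji.symm hjF hjG]
        linarith
      · by_cases hjS : g (f i) = i ∨ g (f j) = j
        · rw [hS i j hji.symm hjF hjG hjS]
          linarith
        · linarith [(abs_le.1 (hN' i j hji.symm hjF hjG hjS)).1]
  · intro i j hji hjg
    -- Here g i is exceptional and i is the other end of the double pair: no other farthest or
    -- raised pair meets i, so its other values stay below offset 2.
    by_cases hi : f (g i) = i
    · have ha : g (f (g i)) = g i := by rw [hi]
      rw [hFG i (g i) (h.far_ne i).symm (Or.inr hi) (Or.inl rfl)]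
      have hnG : ¬ (g i = j ∨ g j = i) := by
        rintro (h1 | h1)
        · exact hjg h1.symm
        · exact h.far_ne_near_of_far_near ha j (h1.trans hi.symm)
      have hnS : ¬ (g (f i) = i ∨ g (f j) = j) := by
        rintro (h1 | h1)
        · exact h.far_ne i (h.far_near_unique h1 ha)
        · exact hjg (h.far_near_unique ha h1)
      by_cases hjF : f i = j ∨ f j = i
      · rw [hF i j hji.symm hjF hnG]
        linarith [hθ1 i j]
      · linarith [(abs_le.1 (hN' i j hji.symm hjF hnG hnS)).2]
    · have hnF : ¬ (f i = g i ∨ f (g i) = i) := by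
        rintro (h1 | h1)
        · exact h.near_ne_far i h1
        · exact hi h1
      rw [hG i (g i) (h.far_ne i).symm hnF (Or.inl rfl)]
      have h1 := hθ1 i j
      have h0 := hθ0 i (g i)
      by_cases hjF : f i = j ∨ f j = i <;> by_cases hjG : g i = j ∨ g j = i
      · rw [hFG i j hji.symm hjF hjG]
        linarith
      · rw [hF i j hji.symm hjF hjG]
        linarith
      · rw [hG i j hji.symm hjF hjG]
        linarith [div_one_add_lt (hD i j) (h.far i j hji hjg)]
      · by_cases hjS : g (f i) = i ∨ g (f j) = j
        · rw [hS i j hji.symm hjF hjG hjS]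
          linarith
        · linarith [(abs_le.1 (hN' i j hji.symm hjF hjG hjS)).2]

end Combinatorics

/-! ### Lower bound and conclusion -/

theorem Realizable.realizableIn_of_nearly_orthonormal {E : Type*} [NormedAddCommGroup E]
    [InnerProductSpace ℝ E] [Nontrivial E] {n : ℕ} (hn : 3 ≤ n) {e : Fin n → E}
    (he : ∀ i, ‖e i‖ = 1) (hee : ∀ i j, i ≠ j → |inner ℝ (e i) (e j)| ≤ 1 / 1000000)
    {f g : Fin n → Fin n} (hfg : Realizable f g) : RealizableIn E f g := by
  obtain ⟨X, _, hf, hg, A, -, h1, h2⟩ := hfg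
  let D : Fin n → Fin n → ℝ := fun i j => dist (A i) (A j)
  have hD : ∀ i j, 0 ≤ D i j := fun i j => dist_nonneg
  have h : NearestFarthest D f g :=
    NearestFarthest.of_three_le hn (fun i j => dist_comm _ _) hf hg h1 h2
  obtain ⟨a, ha⟩ : ∃ a : Fin n, ∀ i, g (f i) = i → i = a := by
    by_cases hex : ∃ a, g (f a) = a
    · obtain ⟨a, ha⟩ := hex
      exact ⟨a, fun i hi => h.far_near_unique ha hi⟩
    · exact ⟨⟨0, by omega⟩, fun i hi => absurd ⟨i, hi⟩ hex⟩
  -- The pair {i, a} is charged to i, so the whole star at a costs each point one extra direction.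
  let Q : Fin n → Finset (Fin n) := fun i => {f i, g i, a}
  have hQ : ∀ i j, j ∈ Q i ↔ j = f i ∨ j = g i ∨ j = a := fun i j => by simp [Q]
  obtain ⟨B, hB, hB'⟩ := exists_tuned he hee (Q := Q) (fun i => Finset.card_le_three)
    (abs_targetSq_sub_le (f := f) (g := g) hD) (targetSq_symm h.symm)
  have hB2 := h.of_near_targetSq hD (N := fun i j => ‖B i - B j‖ ^ 2) (by
      intro i j hij hh
      refine hB i j hij ?_
      rw [hQ, hQ]
      rcases hh with (hh | hh) | (hh | hh) | (hh | hh)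
      · exact Or.inl (Or.inl hh.symm)
      · exact Or.inr (Or.inl hh.symm)
      · exact Or.inl (Or.inr (Or.inl hh.symm))
      · exact Or.inr (Or.inr (Or.inl hh.symm))
      · exact Or.inr (Or.inr (Or.inr (ha i hh)))
      · exact Or.inl (Or.inr (Or.inr (ha j hh)))) (by
      intro i j hij hF hG hS
      -- A tuned pair of no special kind appears only when a is the arbitrary default; its target is
      -- then exactly 2.
      by_cases hQij : j ∈ Q i ∨ i ∈ Q j
      · simp only [hB i j hij hQij, targetSq, if_neg hF, if_neg hG, if_neg hS]
        norm_num
      · rw [not_or] at hQij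
        exact hB' i j hij hQij.1 hQij.2)
  refine RealizableIn.of_strict hf hg B (fun i j hj hj' => ?_) (fun i j hj hj' => ?_)
  · rw [dist_eq_norm, dist_eq_norm, ← sq_lt_sq₀ (norm_nonneg _) (norm_nonneg _)]
    exact hB2.1 i j hj hj'
  · rw [dist_eq_norm, dist_eq_norm, ← sq_lt_sq₀ (norm_nonneg _) (norm_nonneg _)]
    exact hB2.2 i j hj hj'

theorem exists_mem_euclideanSizes_exp_le {k : ℕ} (hk : 0 < k) :
    ∃ n ∈ euclideanSizes k, Real.exp (k * ((1 / 1000000) ^ 2 / 2)) / 2 ≤ n := by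
  have : NeZero k := ⟨hk.ne'⟩
  obtain ⟨n, hn, e, he, hee⟩ := exists_nearly_orthonormal hk (ε := 1 / 1000000) (by norm_num)
    (by norm_num)
  rcases le_or_gt 3 n with h3 | h3
  · exact ⟨n, ⟨h3, fun f g hfg => hfg.realizableIn_of_nearly_orthonormal h3 he hee⟩, hn⟩
  -- When the construction gives fewer than three vectors, size 3 already exceeds the bound.
  · exact ⟨3, three_mem_euclideanSizes hk, hn.trans (by exact_mod_cast h3.le)⟩

theorem theorem2 :
    ∃ A B c C : ℝ, 0 < A ∧ 0 < B ∧ 1 < c ∧ 1 < C ∧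
      ∀ k : ℕ, 0 < k →
        IsGreatest (euclideanSizes k) (maxEuclideanSize k) ∧
          A * c ^ k < (maxEuclideanSize k : ℝ) ∧ (maxEuclideanSize k : ℝ) < B * C ^ k := by
  -- Taking 1/4 instead of 1/2 makes the lower bound strict, and 5^k + 1 < 3 · 5^k.
  refine ⟨1 / 4, 3, Real.exp ((1 / 1000000) ^ 2 / 2), 5, by norm_num, by norm_num,
    Real.one_lt_exp_iff.2 (by norm_num), by norm_num, fun k hk => ?_⟩
  have hbdd : BddAbove (euclideanSizes k) := ⟨5 ^ k + 1, fun n => le_of_mem_euclideanSizes⟩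
  have hmem : maxEuclideanSize k ∈ euclideanSizes k :=
    Nat.sSup_mem ⟨3, three_mem_euclideanSizes hk⟩ hbdd
  refine ⟨⟨hmem, fun n hn => le_csSup hbdd hn⟩, ?_, ?_⟩
  · obtain ⟨n, hn, hle⟩ := exists_mem_euclideanSizes_exp_le hk
    have h1 : (n : ℝ) ≤ maxEuclideanSize k := Nat.cast_le.2 (le_csSup hbdd hn)
    rw [← Real.exp_nat_mul]
    linarith [Real.exp_pos (k * ((1 / 1000000 : ℝ) ^ 2 / 2))]
  · have h1 : (maxEuclideanSize k : ℝ) ≤ 5 ^ k + 1 := by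
      exact_mod_cast le_of_mem_euclideanSizes hmem
    have h2 : (1 : ℝ) ≤ 5 ^ k := one_le_pow₀ (by norm_num)
    linarith
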